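/- Let $G=(V,E)$ be a finite simple graph with $n$ vertices, let $p\colon V\to\mathbb Z_{>0}$, and let $\prec$ be a total order on $V$. For $v\in V$ let $\bar N^-(v)=\{u\in V: u\prec v,\ \{u,v\}\notin E\}$ and $\bar N^+(v)=\{u\in V: v\prec u,\ \{u,v\}\notin E\}$; let $S=\{v:\bar N^-(v)=\emptyset\}$ be the set of sources and $T=\{v:\bar N^+(v)=\emptyset\}$ the set of sinks. Consider a real variable $y$ and variables $x_{uv}$, one for each pair $(u,v)$ with $u\in\bar N^-(v)$ and one, $x_{vv}$, for each $v\in V\setminus S$. Put $\gamma_v=1$ if $v\in S$ and $\gamma_v=x_{vv}$ otherwise. Let $\mathcal P(G,p)$ be the convex hull of all $(y,x)$ with $y\ge 0$, $x$ a $0/1$ vector, and - $\sum_{u\in\bar N^-(v)\cup\{v\}}x_{uv}\ge 1$ for all $v\in V\setminus S$; - $\sum_{u\in K}x_{vu}\le\gamma_v$ for all $v\in V\setminus T$ and all $K\subseteq\bar N^+(v)$ that are cliques of size $2$, or maximal cliques of size $1$, of $G[\bar N^+(v)]$; - $p(v)\gamma_v+\sum_{u\in\bar N^+(v)}p(u)x_{vu}\le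 y$ for all $v\in V$. **Corollary (external inequalities).** Let $v\in V\setminus T$ and $U\subseteq\bar N^+(v)$. For $u\in U$ let $\alpha_u$ be the maximum size of a stable set of $G[U]$ containing $u$. Then the external inequality $$\sum_{u\in U}\frac{1}{\alpha_u}\,x_{vu}\le\gamma_v$$ is valid for $\mathcal P(G,p)$. Moreover, if $U$ is a maximal clique of $G[\bar N^+(v)]$, then the inequality is facet-defining for $\mathcal P(G,p)$, that is, the set of points of $\mathcal P(G,p)$ satisfying it with equality is nonempty and has dimension $\dim\mathcal P(G,p)-1$. -/

import Mathlib

namespace PMC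

noncomputable section

variable {V : Type*} [Fintype V] [LinearOrder V]

open Classical in
/-- The negative anti-neighbourhood: the vertices `u ≺ v` that are not adjacent to `v`. -/
def negAntiNbr (G : SimpleGraph V) (v : V) : Finset V :=
  Finset.univ.filter fun u => u < v ∧ ¬ G.Adj u v

open Classical in
/-- The positive anti-neighbourhood: the vertices `u` with `v ≺ u` that are not adjacent to `v`. -/
def posAntiNbr (G : SimpleGraph V) (v : V) : Finset V :=
  Finset.univ.filter fun u => v < u ∧ ¬ G.Adj u v

/-- A source is a vertex with empty negative anti-neighbourhood. -/
def IsSource (G : SimpleGraph V) (v : V) : Prop := negAntiNbr G v = ∅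

/-- A sink is a vertex with empty positive anti-neighbourhood. -/
def IsSink (G : SimpleGraph V) (v : V) : Prop := posAntiNbr G v = ∅

/-- `(u, v)` indexes a variable `x_{uv}` of the formulation: either `u` is a negative
anti-neighbour of `v`, or `u = v` is not a source. -/
def IsVar (G : SimpleGraph V) (u v : V) : Prop :=
  u ∈ negAntiNbr G v ∨ (u = v ∧ ¬ IsSource G v)

/-- The index set of the variables `x_{uv}`. -/
abbrev Var (G : SimpleGraph V) : Type _ := {e : V × V // IsVar G e.1 e.2}

open Classical in
/-- The number `x_{uv}`. It is only used at pairs `(u, v)` that index a variable; the value `0` at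
the other pairs is a placeholder. -/
def entry (G : SimpleGraph V) (x : Var G → ℝ) (u v : V) : ℝ :=
  if h : IsVar G u v then x ⟨(u, v), h⟩ else 0

open Classical in
/-- `γ_v`, which is `1` if `v` is a source and `x_{vv}` otherwise. -/
def gamma (G : SimpleGraph V) (x : Var G → ℝ) (v : V) : ℝ :=
  if IsSource G v then 1 else entry G x v v

/-- `K` is a maximal clique of the induced subgraph `G[A]`. -/
def IsMaximalCliqueIn (G : SimpleGraph V) (A K : Finset V) : Prop :=
  Maximal (fun s : Finset V => s ⊆ A ∧ G.IsClique (s : Set V)) K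

/-- The members of `𝒦(v)`: subsets of the positive anti-neighbourhood of `v` that are cliques of
size `2`, or maximal cliques of size `1`, of the subgraph induced by this anti-neighbourhood. -/
def IsConflictClique (G : SimpleGraph V) (v : V) (K : Finset V) : Prop :=
  (K ⊆ posAntiNbr G v ∧ G.IsClique (K : Set V) ∧ K.card = 2) ∨
    (IsMaximalCliqueIn G (posAntiNbr G v) K ∧ K.card = 1)

/-- The feasible points `(y, x)` of the representatives formulation without the bound on the number
of machines. By definition of `gamma`, the last two constraints combine the versions for sources
and for non-sources. -/
structure IsFeasible (G : SimpleGraph V) (p : V → ℕ) (z : ℝ × (Var G → ℝ)) : Prop where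
  nonneg : 0 ≤ z.1
  binary : ∀ i, z.2 i = 0 ∨ z.2 i = 1
  cover : ∀ v, ¬ IsSource G v → 1 ≤ ∑ u ∈ insert v (negAntiNbr G v), entry G z.2 u v
  conflict : ∀ v, ¬ IsSink G v → ∀ K, IsConflictClique G v K →
    ∑ u ∈ K, entry G z.2 v u ≤ gamma G z.2 v
  time : ∀ v, (p v : ℝ) * gamma G z.2 v + ∑ u ∈ posAntiNbr G v, (p u : ℝ) * entry G z.2 v u ≤ z.1

/-- The polytope `𝒫(G,p)`. -/
def polytope (G : SimpleGraph V) (p : V → ℕ) : Set (ℝ × (Var G → ℝ)) :=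
  convexHull ℝ {z | IsFeasible G p z}

open Classical in
/-- `α_u`: the maximum size of a stable set of `G[U]` that contains `u`. -/
def stableNum (G : SimpleGraph V) (U : Finset V) (u : V) : ℕ :=
  (U.powerset.filter fun W : Finset V => u ∈ W ∧ G.IsIndepSet (W : Set V)).sup Finset.card

/-- The left-hand side `∑_{u ∈ U} x_{vu} / α_u` of the external inequality. -/
def externalLHS (G : SimpleGraph V) (v : V) (U : Finset V) (z : ℝ × (Var G → ℝ)) : ℝ :=
  ∑ u ∈ U, (1 / (stableNum G U u : ℝ)) * entry G z.2 v u

end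

section Polyhedral

variable {E : Type*} [AddCommGroup E] [Module ℝ E]

/-- The inequality `ℓ z ≤ r z` is valid for `P`. -/
def IsValidIneq (P : Set E) (ℓ r : E → ℝ) : Prop := ∀ z ∈ P, ℓ z ≤ r z

/-- The face of `P` induced by the inequality `ℓ z ≤ r z`. -/
def face (P : Set E) (ℓ r : E → ℝ) : Set E := {z | z ∈ P ∧ ℓ z = r z}

/-- The dimension of a nonempty set: the dimension of its affine hull. -/
noncomputable def dim (P : Set E) : ℕ := Module.finrank ℝ (vectorSpan ℝ P)

/-- The inequality `ℓ z ≤ r z`, with affine sides, is facet-defining for `P`: it is valid, and its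
face is nonempty and has dimension `dim P - 1`. -/
def IsFacetDefining (P : Set E) (ℓ r : E → ℝ) : Prop :=
  IsValidIneq P ℓ r ∧ (face P ℓ r).Nonempty ∧ dim (face P ℓ r) + 1 = dim P

end Polyhedral

end PMC

namespace PMC

noncomputable section

variable {V : Type*} [Fintype V] [LinearOrder V] {G : SimpleGraph V}

/-! Validity need only be checked at feasible 0/1 points, since a half-space is convex. If `γ_v =
0`, every `x_{vu}` vanishes. If `γ_v = 1`, the size-2 conflict constraints make `W = {u ∈ U : x_{vu}
= 1}` stable, so `α_u ≥ |W|` on `W` and the left side is at most `|W| · 1/|W| ≤ 1`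
(`IsFeasible.externalLHS_le`).

For a maximal clique `U` all `α_u` are `1`. The face lies in a translate of the kernel of
`slackLin`, which misses the unit vector of `(v, u₀)` for any `u₀ ∈ U` (`unitVec_notMem_ker`).
Conversely, this vector and the directions of the face span the whole space (`vectorSpan_face_sup`),
so the face has codimension exactly one. The directions come from pairs of points differing in few
coordinates. Such pairs exist because cover constraints are inequalities, so a vertex may be
represented several times, and because `y` may be taken large enough to satisfy every time
constraint. -/

theorem mem_negAntiNbr {u v : V} : u ∈ negAntiNbr G v ↔ u < v ∧ ¬ G.Adj u v := by
  simp [negAntiNbr]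

theorem mem_posAntiNbr {u v : V} : u ∈ posAntiNbr G v ↔ v < u ∧ ¬ G.Adj v u := by
  simp [posAntiNbr, G.adj_comm]

theorem isVar_of_mem_posAntiNbr {u v : V} (h : u ∈ posAntiNbr G v) : IsVar G v u :=
  Or.inl (mem_negAntiNbr.2 (mem_posAntiNbr.1 h))

open Classical in
/-- The linear functional `x ↦ x_{uv}`. -/
def entryLin (G : SimpleGraph V) (u v : V) : (ℝ × (Var G → ℝ)) →ₗ[ℝ] ℝ :=
  if h : IsVar G u v then LinearMap.proj (⟨(u, v), h⟩ : Var G) ∘ₗ LinearMap.snd ℝ ℝ (Var G → ℝ)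
  else 0

theorem entryLin_apply (u v : V) (z : ℝ × (Var G → ℝ)) : entryLin G u v z = entry G z.2 u v := by
  unfold entryLin entry
  split_ifs <;> simp

open Classical in
/-- The linear part of the difference of the two sides of the external inequality. -/
def slackLin (G : SimpleGraph V) (v : V) (U : Finset V) : (ℝ × (Var G → ℝ)) →ₗ[ℝ] ℝ :=
  ∑ u ∈ U, (1 / (stableNum G U u : ℝ)) • entryLin G v u - if IsSource G v then 0 else entryLin G v v

-- For a source, `γ_v` is the constant `1` and contributes nothing to the linear part; the last term
-- corrects for this.
open Classical in
theorem slackLin_apply (v : V) (U : Finset V) (z : ℝ × (Var G → ℝ)) :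
    slackLin G v U z =
      externalLHS G v U z - gamma G z.2 v + if IsSource G v then 1 else 0 := by
  unfold slackLin externalLHS gamma
  split_ifs <;> simp [entryLin_apply, LinearMap.sum_apply]

/-! ### Validity of the external inequalities -/

section Validity

/-- Either `u` lies on an edge of the induced subgraph, or it is isolated there and `{u}` is a
maximal clique. This yields `x_{vu} ≤ γ_v`. -/
theorem exists_isConflictClique {u v : V} (h : u ∈ posAntiNbr G v) :
    ∃ K, IsConflictClique G v K ∧ u ∈ K := by
  classical
  by_cases hw : ∃ w ∈ posAntiNbr G v, G.Adj u w
  · obtain ⟨w, hw, ha⟩ := hw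
    refine ⟨{u, w}, Or.inl ⟨?_, ?_, Finset.card_pair ha.ne⟩, by simp⟩
    · simp [Finset.insert_subset_iff, h, hw]
    · simpa [SimpleGraph.isClique_pair] using fun _ => ha
  · push Not at hw
    refine ⟨{u}, Or.inr ⟨⟨⟨by simpa using h, by simp⟩, ?_⟩, by simp⟩, by simp⟩
    intro s hs hus w hws
    by_contra hne
    have hu : u ∈ s := hus (by simp)
    exact hw w (hs.1 hws) (hs.2 hu hws (by rintro rfl; simp at hne))

theorem IsFeasible.entry_eq {p : V → ℕ} {z : ℝ × (Var G → ℝ)} (hz : IsFeasible G p z) (u v : V) :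
    entry G z.2 u v = 0 ∨ entry G z.2 u v = 1 := by
  unfold entry
  split_ifs
  · exact hz.binary _
  · exact Or.inl rfl

theorem IsFeasible.entry_nonneg {p : V → ℕ} {z : ℝ × (Var G → ℝ)} (hz : IsFeasible G p z)
    (u v : V) : 0 ≤ entry G z.2 u v := by
  rcases hz.entry_eq u v with h | h <;> simp [h]

theorem IsFeasible.gamma_eq {p : V → ℕ} {z : ℝ × (Var G → ℝ)} (hz : IsFeasible G p z) (v : V) :
    gamma G z.2 v = 0 ∨ gamma G z.2 v = 1 := by
  unfold gamma
  split_ifs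
  · exact Or.inr rfl
  · exact hz.entry_eq v v

theorem IsFeasible.entry_le_gamma {p : V → ℕ} {z : ℝ × (Var G → ℝ)} (hz : IsFeasible G p z)
    {u v : V} (h : u ∈ posAntiNbr G v) : entry G z.2 v u ≤ gamma G z.2 v := by
  obtain ⟨K, hK, hu⟩ := exists_isConflictClique h
  have hv : ¬ IsSink G v := fun h' => by simp [IsSink] at h'; simp [h'] at h
  exact (Finset.single_le_sum (f := fun u => entry G z.2 v u)
    (fun w _ => hz.entry_nonneg v w) hu).trans (hz.conflict v hv K hK)

theorem card_le_stableNum {V : Type*} [LinearOrder V] {G : SimpleGraph V} {U W : Finset V} {u : V} (hWU : W ⊆ U) (hu : u ∈ W)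
    (hW : G.IsIndepSet (W : Set V)) : W.card ≤ stableNum G U u := by
  classical
  unfold stableNum
  exact Finset.le_sup (f := Finset.card) (by simp [hWU, hu, hW])

theorem IsFeasible.externalLHS_le {p : V → ℕ} {z : ℝ × (Var G → ℝ)} (hz : IsFeasible G p z)
    {v : V} (hv : ¬ IsSink G v) {U : Finset V} (hU : U ⊆ posAntiNbr G v) :
    externalLHS G v U z ≤ gamma G z.2 v := by
  classical
  unfold externalLHS
  rcases hz.gamma_eq v with hγ | hγ
  · rw [hγ]
    refine Finset.sum_nonpos fun u hu => ?_
    have := hz.entry_le_gamma (hU hu)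
    rw [le_antisymm (hγ ▸ this) (hz.entry_nonneg v u), mul_zero]
  · rw [hγ]
    set W := U.filter fun u => entry G z.2 v u = 1 with hWdef
    -- An edge inside `W` would give `2 ≤ 1` in its conflict constraint.
    have hW : G.IsIndepSet (W : Set V) := by
      intro a ha b hb hab hadj
      simp only [hWdef, Finset.coe_filter, Set.mem_ofPred_eq] at ha hb
      have := hz.conflict v hv {a, b} (Or.inl ⟨by
        simp [Finset.insert_subset_iff, hU ha.1, hU hb.1], by
        simpa [SimpleGraph.isClique_pair] using fun _ => hadj, Finset.card_pair hab⟩)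
      rw [Finset.sum_pair hab, ha.2, hb.2, hγ] at this
      norm_num at this
    have hsum : ∑ u ∈ U, (1 / (stableNum G U u : ℝ)) * entry G z.2 v u
        = ∑ u ∈ W, 1 / (stableNum G U u : ℝ) := by
      rw [hWdef, Finset.sum_filter]
      refine Finset.sum_congr rfl fun u _ => ?_
      rcases hz.entry_eq v u with h | h <;> simp [h]
    rw [hsum]
    calc ∑ u ∈ W, 1 / (stableNum G U u : ℝ) ≤ ∑ _u ∈ W, 1 / (W.card : ℝ) := by
          refine Finset.sum_le_sum fun u hu => ?_
          refine one_div_le_one_div_of_le (by exact_mod_cast Finset.card_pos.2 ⟨u, hu⟩) ?_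
          exact_mod_cast card_le_stableNum (Finset.filter_subset _ _) hu hW
      _ ≤ 1 := by
          rw [Finset.sum_const, nsmul_eq_mul, mul_one_div]
          -- This includes empty `W`, where `0 / 0 = 0`.
          exact div_self_le_one _

theorem isValidIneq_external (p : V → ℕ) {v : V} (hv : ¬ IsSink G v) {U : Finset V}
    (hU : U ⊆ posAntiNbr G v) :
    IsValidIneq (polytope G p) (externalLHS G v U) (fun z => gamma G z.2 v) := by
  classical
  have key : polytope G p ⊆ {z | slackLin G v U z ≤ if IsSource G v then 1 else 0} := by
    refine convexHull_min (fun z hz => ?_) (convex_halfSpace_le (slackLin G v U).isLinear _)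
    have := IsFeasible.externalLHS_le hz hv hU
    simp only [Set.mem_ofPred_eq, slackLin_apply]
    linarith
  intro z hz
  have := key hz
  simp only [Set.mem_ofPred_eq, slackLin_apply] at this
  linarith

end Validity

/-! ### Feasible points built from assignments -/

section Points

open Classical in
/-- The point with first coordinate `y` whose remaining coordinates are the indicator vector of
the set of all pairs `(w, w)` with `w ∉ E` and all pairs in `R`. -/
def repPoint (G : SimpleGraph V) (y : ℝ) (E : Set V) (R : Set (V × V)) : ℝ × (Var G → ℝ) :=
  (y, fun i => if (i.1.1 = i.1.2 ∧ i.1.1 ∉ E) ∨ i.1 ∈ R then 1 else 0)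

open Classical in
theorem entry_repPoint (y : ℝ) (E : Set V) (R : Set (V × V)) (a b : V) :
    entry G (repPoint G y E R).2 a b =
      if IsVar G a b ∧ ((a = b ∧ a ∉ E) ∨ (a, b) ∈ R) then 1 else 0 := by
  unfold entry repPoint
  by_cases h : IsVar G a b <;> simp [h]

theorem entry_repPoint_nonneg (y : ℝ) (E : Set V) (R : Set (V × V)) (a b : V) :
    0 ≤ entry G (repPoint G y E R).2 a b := by
  rw [entry_repPoint]; split_ifs <;> norm_num

theorem entry_repPoint_le_one (y : ℝ) (E : Set V) (R : Set (V × V)) (a b : V) :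
    entry G (repPoint G y E R).2 a b ≤ 1 := by
  rw [entry_repPoint]; split_ifs <;> norm_num

theorem gamma_repPoint_nonneg (y : ℝ) (E : Set V) (R : Set (V × V)) (a : V) :
    0 ≤ gamma G (repPoint G y E R).2 a := by
  unfold gamma; split_ifs
  · norm_num
  · exact entry_repPoint_nonneg ..

theorem gamma_repPoint_le_one (y : ℝ) (E : Set V) (R : Set (V × V)) (a : V) :
    gamma G (repPoint G y E R).2 a ≤ 1 := by
  unfold gamma; split_ifs
  · exact le_rfl
  · exact entry_repPoint_le_one ..

theorem gamma_repPoint_of_notMem (y : ℝ) {E : Set V} (R : Set (V × V)) {a : V} (ha : a ∉ E) :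
    gamma G (repPoint G y E R).2 a = 1 := by
  unfold gamma
  split_ifs with h
  · rfl
  · rw [entry_repPoint, if_pos ⟨Or.inr ⟨rfl, h⟩, Or.inl ⟨rfl, ha⟩⟩]

/-- Every vertex of `E` is represented by another vertex, the pairs in `R` have representatives
outside `E`, and any two vertices with the same representative are non-adjacent. -/
structure IsAssignment (G : SimpleGraph V) (E : Set V) (R : Set (V × V)) : Prop where
  cover : ∀ w ∈ E, ∃ a ∈ negAntiNbr G w, (a, w) ∈ R
  fst_notMem : ∀ a b, (a, b) ∈ R → a ∉ E
  not_adj : ∀ a b c, (a, b) ∈ R → (a, c) ∈ R → ¬ G.Adj b c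

theorem IsAssignment.isFeasible {p : V → ℕ} {E : Set V} {R : Set (V × V)}
    (h : IsAssignment G E R) {y : ℝ} (hy : 2 * ∑ w, (p w : ℝ) ≤ y) :
    IsFeasible G p (repPoint G y E R) where
  nonneg := le_trans (by positivity) hy
  binary i := by
    simp only [repPoint]
    split_ifs <;> simp
  cover w hw := by
    have key : ∃ a ∈ insert w (negAntiNbr G w), entry G (repPoint G y E R).2 a w = 1 := by
      by_cases hwE : w ∈ E
      · obtain ⟨a, ha, haR⟩ := h.cover w hwE
        exact ⟨a, by simp [ha], by rw [entry_repPoint, if_pos ⟨Or.inl ha, Or.inr haR⟩]⟩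
      · exact ⟨w, by simp, by
          rw [entry_repPoint, if_pos ⟨Or.inr ⟨rfl, hw⟩, Or.inl ⟨rfl, hwE⟩⟩]⟩
    obtain ⟨a, ha, ha1⟩ := key
    rw [← ha1]
    exact Finset.single_le_sum (f := fun u => entry G (repPoint G y E R).2 u w)
      (fun u _ => entry_repPoint_nonneg ..) ha
  conflict a _ K hK := by
    classical
    have hKs : K ⊆ posAntiNbr G a := by
      rcases hK with hK | hK
      exacts [hK.1, hK.1.1.1]
    have hKc : G.IsClique (K : Set V) := by
      rcases hK with hK | hK
      exacts [hK.2.1, hK.1.1.2]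
    have hent : ∀ b ∈ K, entry G (repPoint G y E R).2 a b = if (a, b) ∈ R then 1 else 0 := by
      intro b hb
      have hab := (mem_posAntiNbr.1 (hKs hb)).1.ne
      rw [entry_repPoint]
      simp [isVar_of_mem_posAntiNbr (hKs hb), hab]
    rw [Finset.sum_congr rfl hent]
    -- If `a` represents some vertex, then `γ_a = 1`, and the clique `K` contains at most one vertex
    -- represented by `a`.
    by_cases hex : ∃ b ∈ K, (a, b) ∈ R
    · obtain ⟨b, _, hbR⟩ := hex
      rw [gamma_repPoint_of_notMem _ _ (h.fst_notMem a b hbR), Finset.sum_boole]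
      have : (K.filter fun b => (a, b) ∈ R).card ≤ 1 := by
        rw [Finset.card_le_one]
        intro c hc d hd
        rw [Finset.mem_filter] at hc hd
        by_contra hcd
        exact h.not_adj a c d hc.2 hd.2 (hKc hc.1 hd.1 hcd)
      exact_mod_cast this
    · push Not at hex
      rw [Finset.sum_eq_zero fun b hb => if_neg (hex b hb)]
      exact gamma_repPoint_nonneg ..
  time a := by
    refine le_trans ?_ hy
    -- One copy of `∑ p` bounds the `γ` term, the other bounds the sum over the anti-neighbourhood.
    rw [two_mul]
    refine add_le_add ?_ ?_
    · refine (mul_le_of_le_one_right (Nat.cast_nonneg _) (gamma_repPoint_le_one ..)).trans ?_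
      exact Finset.single_le_sum (f := fun w => (p w : ℝ)) (fun _ _ => Nat.cast_nonneg _)
        (Finset.mem_univ a)
    · refine (Finset.sum_le_sum fun u _ =>
        mul_le_of_le_one_right (Nat.cast_nonneg _) (entry_repPoint_le_one ..)).trans ?_
      exact Finset.sum_le_sum_of_subset_of_nonneg (Finset.subset_univ _)
        fun _ _ _ => Nat.cast_nonneg _

end Points

/-! ### Facets from maximal cliques -/

section Facet

/-- The sole use of maximality: a vertex `w` adjacent to all of `U` could be added to `U`, hence
would lie in `U` and be adjacent to itself. For `w ∈ U` the witness may be `w`. -/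
theorem IsMaximalCliqueIn.exists_not_adj {V : Type*} {G : SimpleGraph V} {A U : Finset V} (h : IsMaximalCliqueIn G A U) {w : V}
    (hw : w ∈ A) : ∃ u ∈ U, ¬ G.Adj u w := by
  classical
  by_contra! hc
  have hcl : G.IsClique ((insert w U : Finset V) : Set V) := by
    rw [Finset.coe_insert]
    exact h.1.2.insert fun b hb _ => (hc b hb).symm
  have hle := h.2 (y := insert w U) ⟨Finset.insert_subset hw h.1.1, hcl⟩ (Finset.subset_insert _ _)
  exact G.irrefl (hc w (hle (Finset.mem_insert_self _ _)))

theorem stableNum_eq_one {V : Type*} [LinearOrder V] {G : SimpleGraph V} {U : Finset V} (hU : G.IsClique (U : Set V)) {u : V} (hu : u ∈ U) :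
    stableNum G U u = 1 := by
  classical
  refine le_antisymm ?_ ?_
  · unfold stableNum
    refine Finset.sup_le fun W hW => ?_
    simp only [Finset.mem_filter, Finset.mem_powerset] at hW
    rw [Finset.card_le_one]
    intro a ha b hb
    by_contra hab
    exact hW.2.2 ha hb hab (hU (hW.1 ha) (hW.1 hb) hab)
  · simpa using card_le_stableNum (G := G) (Finset.singleton_subset_iff.2 hu)
      (Finset.mem_singleton_self u) (by simp)

variable {p : V → ℕ} {v : V} {U : Finset V}

/-- Validity leaves only `≥`. If `γ_v = 1`, the single term given by `htight` already equals `1`;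
otherwise `γ_v = 0` and the terms are nonnegative. -/
theorem IsAssignment.mem_face (hv : ¬ IsSink G v) (hU : IsMaximalCliqueIn G (posAntiNbr G v) U)
    {E : Set V} {R : Set (V × V)} (h : IsAssignment G E R) {y : ℝ}
    (hy : 2 * ∑ w, (p w : ℝ) ≤ y) (htight : (IsSource G v ∨ v ∉ E) → ∃ u ∈ U, (v, u) ∈ R) :
    repPoint G y E R ∈ face (polytope G p) (externalLHS G v U) (fun z => gamma G z.2 v) := by
  classical
  have hf := h.isFeasible hy
  refine ⟨subset_convexHull ℝ _ hf, le_antisymm (hf.externalLHS_le hv hU.1.1) ?_⟩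
  have hnn : ∀ u ∈ U, 0 ≤ (1 / (stableNum G U u : ℝ)) * entry G (repPoint G y E R).2 v u :=
    fun u _ => mul_nonneg (by positivity) (entry_repPoint_nonneg ..)
  by_cases hγ : IsSource G v ∨ v ∉ E
  · obtain ⟨u, hu, huR⟩ := htight hγ
    refine (gamma_repPoint_le_one ..).trans (le_trans ?_ (Finset.single_le_sum hnn hu))
    rw [stableNum_eq_one hU.1.2 hu, entry_repPoint,
      if_pos ⟨isVar_of_mem_posAntiNbr (hU.1.1 hu), Or.inr huR⟩]
    norm_num
  · push Not at hγ
    refine le_trans (le_of_eq ?_) (Finset.sum_nonneg hnn)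
    have : (v, v) ∉ R := fun hR => h.fst_notMem v v hR hγ.2
    simp [gamma, hγ.1, entry_repPoint, hγ.2, this]

/-- The unit vector of the coordinate `i`. -/
def unitVec (i : Var G) : ℝ × (Var G → ℝ) := (0, Pi.single i 1)

theorem repPoint_insert_sub (y : ℝ) (E : Set V) (R : Set (V × V)) (i : Var G)
    (hi : i.1.1 = i.1.2 → i.1.1 ∈ E) (hR : i.1 ∉ R) :
    repPoint G y E (insert i.1 R) - repPoint G y E R = unitVec i := by
  classical
  ext j
  · simp [repPoint, unitVec]
  · by_cases hj : j = i
    · subst hj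
      simp only [repPoint, unitVec, Prod.mk_sub_mk, Pi.sub_apply, Pi.single_eq_same]
      rw [if_pos (Or.inr (Set.mem_insert _ _)), if_neg, sub_zero]
      rintro (h | h)
      exacts [h.2 (hi h.1), hR h]
    · have hj' : j.1 ≠ i.1 := fun h => hj (Subtype.ext h)
      simp [repPoint, unitVec, hj, hj']

/-- Removing `w` from the exceptional set has the same effect as adding `(w, w)` to `R`. -/
theorem repPoint_empty_sub_singleton (y : ℝ) (R : Set (V × V)) (i : Var G) (w : V)
    (hi : i.1 = (w, w)) (hR : i.1 ∉ R) :
    repPoint G y ∅ R - repPoint G y {w} R = unitVec i := by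
  classical
  rw [← repPoint_insert_sub y {w} R i (by simp [hi]) hR]
  congr 1
  ext j
  · rfl
  · have : (j.1.1 = j.1.2 ∧ j.1.1 ∉ (∅ : Set V) ∨ j.1 ∈ R) ↔
        (j.1.1 = j.1.2 ∧ j.1.1 ∉ ({w} : Set V) ∨ j.1 ∈ insert i.1 R) := by
      rw [hi, Set.mem_insert_iff, Prod.ext_iff]
      simp only [Set.mem_empty_iff_false, Set.mem_singleton_iff]
      grind
    simp only [repPoint]
    split_ifs with h₁ h₂ h₂
    exacts [rfl, absurd (this.1 h₁) h₂, absurd (this.2 h₂) h₁, rfl]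

theorem eq_top_of_unitVec_mem {W : Submodule ℝ (ℝ × (Var G → ℝ))} (hy : ((1 : ℝ), 0) ∈ W)
    (hx : ∀ i, unitVec i ∈ W) : W = ⊤ := by
  classical
  rw [eq_top_iff]
  rintro ⟨y, x⟩ -
  have : (y, x) = y • ((1 : ℝ), (0 : Var G → ℝ)) + ∑ i, x i • unitVec i := by
    ext j
    · simp [unitVec, Prod.fst_sum]
    · simp [unitVec, Prod.snd_sum, Finset.sum_apply, Pi.single_apply]
  rw [this]
  exact W.add_mem (W.smul_mem _ hy) (W.sum_mem fun i _ => W.smul_mem _ (hx i))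

/-- With the unit vector of one `(v, u₀)`, `u₀ ∈ U`, the directions of the face span everything. -/
theorem vectorSpan_face_sup (p : V → ℕ) (hv : ¬ IsSink G v)
    (hU : IsMaximalCliqueIn G (posAntiNbr G v) U) {u₀ : V} (hu₀ : u₀ ∈ U) :
    vectorSpan ℝ (face (polytope G p) (externalLHS G v U) (fun z => gamma G z.2 v)) ⊔
      Submodule.span ℝ {unitVec ⟨(v, u₀), isVar_of_mem_posAntiNbr (hU.1.1 hu₀)⟩} = ⊤ := by
  classical
  set F := face (polytope G p) (externalLHS G v U) (fun z => gamma G z.2 v) with hF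
  set i₀ : Var G := ⟨(v, u₀), isVar_of_mem_posAntiNbr (hU.1.1 hu₀)⟩ with hi₀
  set W := vectorSpan ℝ F ⊔ Submodule.span ℝ {unitVec i₀} with hW
  have hle : vectorSpan ℝ F ≤ W := le_sup_left
  have h₀ : unitVec i₀ ∈ W := Submodule.mem_sup_right (Submodule.mem_span_singleton_self _)
  set M : ℝ := 2 * ∑ w, (p w : ℝ) with hM
  have hsub : ∀ {a b}, a ∈ F → b ∈ F → a - b ∈ W := fun ha hb =>
    hle (vsub_mem_vectorSpan ℝ ha hb)
  have hpos : ∀ {u}, u ∈ U → v < u := fun hu => (mem_posAntiNbr.1 (hU.1.1 hu)).1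
  have hmem : ∀ {E R}, IsAssignment G E R →
      ((IsSource G v ∨ v ∉ E) → ∃ u ∈ U, (v, u) ∈ R) → repPoint G M E R ∈ F :=
    fun h ht => h.mem_face hv hU le_rfl ht
  have hbase : ∀ u ∈ U, IsAssignment G ∅ {(v, u)} := fun u _ =>
    ⟨by simp, by simp, by
      intro a b c hb hc
      simp only [Set.mem_singleton_iff, Prod.mk.injEq] at hb hc
      rw [hb.2, hc.2]; exact G.irrefl⟩
  have hbase' : ∀ u ∈ U, repPoint G M ∅ {(v, u)} ∈ F := fun u hu =>
    hmem (hbase u hu) fun _ => ⟨u, hu, rfl⟩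
  have harc : ∀ u ∈ U, ∀ a b, a ≠ v → IsAssignment G ∅ {(a, b), (v, u)} := by
    intro u _ a b hav
    refine ⟨by simp, by simp, ?_⟩
    intro c d e hd he
    simp only [Set.mem_insert_iff, Set.mem_singleton_iff, Prod.mk.injEq] at hd he
    rcases hd with ⟨rfl, rfl⟩ | ⟨rfl, rfl⟩ <;> rcases he with ⟨h, rfl⟩ | ⟨h, rfl⟩
    all_goals first | exact G.irrefl | exact absurd h hav | exact absurd h.symm hav
  have hpair : ∀ u ∈ U, ∀ w, ¬ G.Adj u w → IsAssignment G ∅ {(v, w), (v, u)} := by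
    intro u _ w huw
    refine ⟨by simp, by simp, ?_⟩
    intro c d e hd he
    simp only [Set.mem_insert_iff, Set.mem_singleton_iff, Prod.mk.injEq] at hd he
    rcases hd with ⟨rfl, rfl⟩ | ⟨rfl, rfl⟩ <;> rcases he with ⟨-, rfl⟩ | ⟨-, rfl⟩
    all_goals first | exact G.irrefl | exact huw | exact fun h => huw h.symm
  -- the unit vectors of the pairs `(v, u)` with `u ∈ U`
  have hUmem : ∀ i : Var G, i.1.1 = v → i.1.2 ∈ U → unitVec i ∈ W := by
    rintro ⟨⟨a, u⟩, hi⟩ rfl hu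
    dsimp only at *
    -- The common base point is off the face, but it cancels when the two unit vectors are
    -- subtracted.
    have e₁ := repPoint_insert_sub M ∅ ∅ ⟨(a, u), hi⟩ (fun h => absurd h (hpos hu).ne) (by simp)
    have e₀ := repPoint_insert_sub M ∅ ∅ i₀ (fun h => absurd h (hpos hu₀).ne) (by simp)
    have := W.add_mem (hsub (hbase' u hu) (hbase' u₀ hu₀)) h₀
    rw [← e₀] at this
    rw [← e₁]
    simpa [hi₀] using this
  refine eq_top_of_unitVec_mem ?_ ?_
  -- Raising `y` alone stays in the face and gives its direction.
  · have := hsub ((hbase u₀ hu₀).mem_face (p := p) (y := M + 1) hv hU (by linarith)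
      fun _ => ⟨u₀, hu₀, rfl⟩) (hbase' u₀ hu₀)
    simpa [repPoint] using this
  · rintro ⟨⟨a, b⟩, hi⟩
    by_cases hab : a = b
    · subst hab
      have hns : ¬ IsSource G a := by
        rcases hi with h | h
        · exact absurd (mem_negAntiNbr.1 h).1 (lt_irrefl _)
        · exact h.2
      obtain ⟨c, hc⟩ : (negAntiNbr G a).Nonempty := Finset.nonempty_iff_ne_empty.2 hns
      have hca := (mem_negAntiNbr.1 hc).1
      by_cases hav : a = v
      · subst hav
        -- `v` is represented by `c`
        have h₁ : IsAssignment G {a} {(c, a)} := ⟨by simpa using hc, by simp [hca.ne], by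
            intro d e f he hf
            simp only [Set.mem_singleton_iff, Prod.mk.injEq] at he hf
            rw [he.2, hf.2]; exact G.irrefl⟩
        have hF₁ : repPoint G M {a} {(c, a)} ∈ F := hmem h₁ (by simp [hns])
        have hF₂ : repPoint G M ∅ {(c, a), (a, u₀)} ∈ F :=
          hmem (harc u₀ hu₀ c a hca.ne) fun _ => ⟨u₀, hu₀, by simp⟩
        have e₁ := repPoint_empty_sub_singleton M {(c, a)} ⟨(a, a), hi⟩ a rfl
          (by simp [hca.ne'])
        have e₂ := repPoint_insert_sub M ∅ {(c, a)} i₀ (fun h => absurd h (hpos hu₀).ne)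
          (by simp [hi₀, hca.ne'])
        -- Switching off `γ_v` forces `x_{vu₀}` off as well, so this difference is the sum of the
        -- two unit vectors; the known one is subtracted.
        have := W.add_mem (hsub hF₂ hF₁) (W.neg_mem h₀)
        rw [Set.pair_comm, ← e₂] at this
        rw [← e₁]
        convert this using 1
        simp only [hi₀]
        abel
      · by_cases hva : a ∈ posAntiNbr G v
        -- Here `v` itself can represent `a`, alongside a `u ∈ U` not adjacent to `a` that keeps the
        -- inequality tight.
        · obtain ⟨u, hu, hua⟩ := hU.exists_not_adj hva
          have h₁ := hpair u hu a hua
          have h₂ : IsAssignment G {a} {(v, a), (v, u)} :=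
            ⟨fun w hw => ⟨v, by rw [hw]; exact mem_negAntiNbr.2 (mem_posAntiNbr.1 hva), by
                rw [hw]; simp⟩, by
              intro c d h
              simp only [Set.mem_insert_iff, Set.mem_singleton_iff, Prod.mk.injEq] at h ⊢
              rintro rfl
              rcases h with h | h <;> exact hav h.1, h₁.not_adj⟩
          rw [← repPoint_empty_sub_singleton M {(v, a), (v, u)} ⟨(a, a), hi⟩ a rfl
            (by simp [hav])]
          exact hsub (hmem h₁ fun _ => ⟨u, hu, by simp⟩) (hmem h₂ fun _ => ⟨u, hu, by simp⟩)
        -- Here the representative `c` of `a` differs from `v`, so the pair `(c, a)` does not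
        -- interfere with `(v, u₀)`.
        · have hcv : c ≠ v := by
            rintro rfl
            exact hva (mem_posAntiNbr.2 (mem_negAntiNbr.1 hc))
          have h₁ := harc u₀ hu₀ c a hcv
          have h₂ : IsAssignment G {a} {(c, a), (v, u₀)} :=
            ⟨fun w hw => ⟨c, by rw [hw]; exact hc, by rw [hw]; simp⟩, by
              intro d e h
              simp only [Set.mem_insert_iff, Set.mem_singleton_iff, Prod.mk.injEq] at h ⊢
              rintro rfl
              rcases h with h | h
              exacts [hca.ne' h.1, hav h.1], h₁.not_adj⟩
          rw [← repPoint_empty_sub_singleton M {(c, a), (v, u₀)} ⟨(a, a), hi⟩ a rfl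
            (by simp [hav, hca.ne'])]
          exact hsub (hmem h₁ fun _ => ⟨u₀, hu₀, by simp⟩) (hmem h₂ fun _ => ⟨u₀, hu₀, by simp⟩)
    · have hba : a ∈ negAntiNbr G b := hi.resolve_right fun h => hab h.1
      by_cases hav : a = v
      · by_cases hbU : b ∈ U
        · exact hUmem _ hav hbU
        · subst hav
          -- A non-neighbour `u ∈ U` of `b` keeps the point tight whether or not `v` also represents
          -- `b`.
          obtain ⟨u, hu, hub⟩ := hU.exists_not_adj (mem_posAntiNbr.2 (mem_negAntiNbr.1 hba))
          rw [← repPoint_insert_sub M ∅ {(a, u)} ⟨(a, b), hi⟩ (fun h => absurd h hab) (by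
            simp only [Set.mem_singleton_iff, Prod.mk.injEq, true_and]
            rintro rfl
            exact hbU hu)]
          exact hsub (hmem (hpair u hu b hub) fun _ => ⟨u, hu, by simp⟩) (hbase' u hu)
      · rw [← repPoint_insert_sub M ∅ {(v, u₀)} ⟨(a, b), hi⟩ (fun h => absurd h hab)
          (by simp [hav])]
        exact hsub (hmem (harc u₀ hu₀ a b hav) fun _ => ⟨u₀, hu₀, by simp⟩) (hbase' u₀ hu₀)

theorem vectorSpan_face_le (P : Set (ℝ × (Var G → ℝ))) (v : V) (U : Finset V) :
    vectorSpan ℝ (face P (externalLHS G v U) (fun z => gamma G z.2 v)) ≤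
      LinearMap.ker (slackLin G v U) := by
  rw [vectorSpan, Submodule.span_le]
  rintro _ ⟨a, ha, b, hb, rfl⟩
  have ha' : externalLHS G v U a = gamma G a.2 v := ha.2
  have hb' : externalLHS G v U b = gamma G b.2 v := hb.2
  show slackLin G v U (a - b) = 0
  rw [map_sub, slackLin_apply, slackLin_apply,
    ha', hb']
  ring

theorem unitVec_notMem_ker (hU : G.IsClique (U : Set V)) (hUv : U ⊆ posAntiNbr G v) {u₀ : V}
    (hu₀ : u₀ ∈ U) :
    unitVec ⟨(v, u₀), isVar_of_mem_posAntiNbr (hUv hu₀)⟩ ∉ LinearMap.ker (slackLin G v U) := by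
  classical
  set i₀ : Var G := ⟨(v, u₀), isVar_of_mem_posAntiNbr (hUv hu₀)⟩
  have hlt := (mem_posAntiNbr.1 (hUv hu₀)).1
  have hent : ∀ b, entryLin G v b (unitVec i₀) = if b = u₀ then 1 else 0 := by
    intro b
    rw [entryLin_apply]
    by_cases hb : b = u₀
    · subst hb
      simp [entry, isVar_of_mem_posAntiNbr (hUv hu₀), unitVec, i₀]
    · simp [entry, unitVec, i₀, hb]
  rw [LinearMap.mem_ker]
  have : slackLin G v U (unitVec i₀) = 1 := by
    unfold slackLin
    split_ifs <;>
      simp [LinearMap.sum_apply, hent, hlt.ne, hu₀, stableNum_eq_one hU hu₀]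
  rw [this]
  exact one_ne_zero

theorem isFacetDefining_external (p : V → ℕ) (hv : ¬ IsSink G v)
    (hU : IsMaximalCliqueIn G (posAntiNbr G v) U) :
    IsFacetDefining (polytope G p) (externalLHS G v U) (fun z => gamma G z.2 v) := by
  classical
  obtain ⟨w, hw⟩ : (posAntiNbr G v).Nonempty := Finset.nonempty_iff_ne_empty.2 hv
  obtain ⟨u₀, hu₀, -⟩ := hU.exists_not_adj hw
  have hpos := (mem_posAntiNbr.1 (hU.1.1 hu₀)).1
  set i₀ : Var G := ⟨(v, u₀), isVar_of_mem_posAntiNbr (hU.1.1 hu₀)⟩ with hi₀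
  have hsup := vectorSpan_face_sup p hv hU hu₀
  have hker := unitVec_notMem_ker hU.1.2 hU.1.1 hu₀
  have hfk := vectorSpan_face_le (polytope G p) v U
  set F := face (polytope G p) (externalLHS G v U) (fun z => gamma G z.2 v) with hF
  have h₀ : IsAssignment G ∅ ∅ := ⟨by simp, by simp, by simp⟩
  have h₁ : IsAssignment G ∅ {(v, u₀)} := ⟨by simp, by simp, by
      intro a b c hb hc
      simp only [Set.mem_singleton_iff, Prod.mk.injEq] at hb hc
      rw [hb.2, hc.2]; exact G.irrefl⟩
  have hmem : repPoint G (2 * ∑ w, (p w : ℝ)) ∅ {(v, u₀)} ∈ F :=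
    h₁.mem_face hv hU le_rfl fun _ => ⟨u₀, hu₀, rfl⟩
  -- The polytope is full-dimensional: the point where every vertex represents only itself is
  -- feasible but off the face, and supplies the missing unit vector.
  have htop : vectorSpan ℝ (polytope G p) = ⊤ := by
    rw [eq_top_iff, ← hsup]
    refine sup_le (vectorSpan_mono ℝ fun z hz => hz.1) ?_
    rw [Submodule.span_singleton_le_iff_mem,
      ← repPoint_insert_sub (2 * ∑ w, (p w : ℝ)) ∅ ∅ i₀ (fun h => absurd h hpos.ne) (by simp)]
    exact vsub_mem_vectorSpan ℝ
      (by simpa [hi₀] using hmem.1) (subset_convexHull ℝ _ (h₀.isFeasible le_rfl))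
  refine ⟨isValidIneq_external p hv hU.1.1, ⟨_, hmem⟩, ?_⟩
  unfold dim
  rw [htop, finrank_top]
  -- The rank of the face is squeezed: it is below the full rank, and one extra vector suffices to
  -- reach the full rank.
  have hlt : Module.finrank ℝ (vectorSpan ℝ F) < Module.finrank ℝ (ℝ × (Var G → ℝ)) :=
    Submodule.finrank_lt fun h => hker (hfk (h ▸ Submodule.mem_top))
  have hadd := Submodule.finrank_add_le_finrank_add_finrank (vectorSpan ℝ F)
    (Submodule.span ℝ {unitVec i₀})
  rw [hsup, finrank_top] at hadd
  have hne : unitVec i₀ ≠ 0 := fun h => hker (h.symm ▸ Submodule.zero_mem _)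
  rw [finrank_span_singleton hne] at hadd
  rw [← hF]
  omega

end Facet

end

end PMC

theorem mainTheorem6 {V : Type*} [Fintype V] [LinearOrder V] (G : SimpleGraph V)
    (p : V → ℕ) (hp : ∀ v, 0 < p v) (v : V) (hv : ¬ PMC.IsSink G v)
    (U : Finset V) (hU : U ⊆ PMC.posAntiNbr G v) :
    PMC.IsValidIneq (PMC.polytope G p)
        (PMC.externalLHS G v U) (fun z => PMC.gamma G z.2 v) ∧
      (PMC.IsMaximalCliqueIn G (PMC.posAntiNbr G v) U →
        PMC.IsFacetDefining (PMC.polytope G p)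
          (PMC.externalLHS G v U) (fun z => PMC.gamma G z.2 v)) :=
  ⟨PMC.isValidIneq_external p hv hU, PMC.isFacetDefining_external p hv⟩
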